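/- Let $\mathbb{X}=(X_n)_{n\ge 1}$ be a strictly stationary and ergodic sequence of real random variables on a probability space $(\Omega,\mathcal F,\mathbb P)$, let $V$ be an almost surely positive random variable on the same space, and put $S_n=V\cdot X_n$, $n\ge 1$, where the sequence $\mathbb{S}=(S_n)_{n\ge 1}$ is assumed to be strictly stationary (this holds, for instance, when $V$ is independent of $\mathbb{X}$). Let $a>0$ and let $(k_n)_{n\ge1}$ be integers with $1\le k_n\le n$ for all $n\ge 1$ and $k_n/n\to 1$. For $n\ge 1$ let $S_{1:n}\le\dots\le S_{n:n}$ be the order statistics of $S_1,\dots,S_n$ and $$K^{\mathbb S}(k_n,n,a)=\#\{1\le i\le n:\ S_{k_n:n}-a<S_i<S_{k_n:n}\},$$ with the convention that this number is $0$ for $n=0$. Let $\gamma_1^{X_1}=\sup\{x\in\mathbb R:\ \mathbb P(X_1\le x)<1\}$, and let $\mathcal I^{\mathbb S}$ be the sigma-field of all events $A$ for which there is a Borel set $B\subseteq\mathbb R^{\mathbb N}$ with $A=\{\omega:(S_i(\omega),S_{i+1}(\omega),\dots)\in B\}$ for every $i\ge 1$. Assume that $\gamma_1^{X_1}<\infty$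 and $$\mathbb P(X_1=\gamma_1^{X_1})=\mathbb P\Big(X_1+\frac aV=\gamma_1^{X_1}\Big)=0 .$$ Put $L=\mathbb P\big(X_1+\frac aV>\gamma_1^{X_1}\,\big|\,\mathcal I^{\mathbb S}\big)$. Then $$\frac{K^{\mathbb S}(k_n,n,a)}{n}\longrightarrow L\quad\text{almost surely as }n\to\infty .$$ Moreover, let $(N(t))_{t\ge0}$ be non-negative integer-valued random variables, $Z$ an almost surely positive random variable (all on $(\Omega,\mathcal F,\mathbb P)$), $c:[0,\infty)\to\mathbb R$ a function with $c(t)>0$ for $t>0$ and $c(t)\to\infty$ as $t\to\infty$, and put $\mathcal K^{\mathbb S}_t=K^{\mathbb S}(k_{N(t)},N(t),a)$. Then, as $t\to\infty$: * if $N(t)/c(t)\to Z$ almost surely, then $\mathcal K^{\mathbb S}_t/c(t)\to Z\cdot L$ almost surely; * if $N(t)/c(t)\to Z$ in probability, then $\mathcal K^{\mathbb S}_t/c(t)\to Z\cdot L$ in probability; * if $N(t)/c(t)\to Z$ in distribution and $L$ is degenerate (almost surely constant), then $\mathcal K^{\mathbb S}_t/c(t)\to Z\cdot L$ in distribution. 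-/

import Mathlib

open MeasureTheory ProbabilityTheory Filter Topology
open scoped NNReal

/-- The left shift `(x₁, x₂, …) ↦ (x₂, x₃, …)` on real sequences. Sequences are indexed by `ℕ`
starting from `0`, so the term `x₁` of the mathematical notation is `x 0`. -/
def seqShift (x : ℕ → ℝ) : ℕ → ℝ := fun n => x (n + 1)

/-- The law on `ℝ^ℕ` of a sequence `X` of random variables. -/
noncomputable def seqLaw {Ω : Type*} [MeasurableSpace Ω] (P : Measure Ω) (X : ℕ → Ω → ℝ) :
    Measure (ℕ → ℝ) :=
  P.map (fun ω n => X n ω)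

/-- Strict stationarity: the law of the sequence is invariant under the shift. -/
def IsStrictlyStationary {Ω : Type*} [MeasurableSpace Ω] (P : Measure Ω) (X : ℕ → Ω → ℝ) : Prop :=
  MeasurePreserving seqShift (seqLaw P X) (seqLaw P X)

/-- Strict stationarity together with ergodicity: the shift is an ergodic (in particular measure
preserving) transformation for the law of the sequence. -/
def IsStationaryErgodic {Ω : Type*} [MeasurableSpace Ω] (P : Measure Ω) (X : ℕ → Ω → ℝ) : Prop :=
  Ergodic seqShift (seqLaw P X)

/-- The sigma-field of the events invariant with respect to the sequence `X`: the sets `A` for which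
there is a Borel set `B ⊆ ℝ^ℕ` with `A = {ω | (X i ω, X (i + 1) ω, …) ∈ B}` for every `i`. -/
def invariantSigma {Ω : Type*} (X : ℕ → Ω → ℝ) : MeasurableSpace Ω where
  MeasurableSet' A := ∃ B : Set (ℕ → ℝ), MeasurableSet B ∧
    ∀ i : ℕ, A = {ω | (fun n => X (i + n) ω) ∈ B}
  measurableSet_empty := ⟨∅, MeasurableSet.empty, fun _ => by simp⟩
  measurableSet_compl := by
    rintro A ⟨B, hB, h⟩
    refine ⟨Bᶜ, hB.compl, fun i => ?_⟩
    rw [h i]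
    rfl
  measurableSet_iUnion := by
    intro A hA
    choose B hB h using hA
    refine ⟨⋃ j, B j, MeasurableSet.iUnion hB, fun i => ?_⟩
    ext ω
    simp only [Set.mem_iUnion, Set.mem_setOf_eq]
    exact exists_congr fun j => by rw [h j i]; rfl

/-- The right endpoint `sup {x ∈ ℝ | F x < 1}` of the support of a random variable with
distribution function `F`, as an extended real number. -/
noncomputable def rightEndpoint {Ω : Type*} [MeasurableSpace Ω] (P : Measure Ω) (Y : Ω → ℝ) :
    EReal :=
  sSup ((fun x : ℝ => (x : EReal)) '' {x : ℝ | cdf (P.map Y) x < 1})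

/-- The order statistic `x_{k:n}`: the `k`-th smallest of the first `n` terms `x 0, …, x (n - 1)`,
for `1 ≤ k ≤ n` (with the value `0` for other `k`, which is never used). -/
noncomputable def orderStat (x : ℕ → ℝ) (k n : ℕ) : ℝ :=
  if h : 1 ≤ k ∧ k ≤ n then
    x (Tuple.sort (fun i : Fin n => x i) ⟨k - 1, by omega⟩)
  else 0

/-- `K(k, n, a)`: the number of the first `n` terms lying in the open interval
`(x_{k:n} - a, x_{k:n})`. It is `0` for `n = 0`. -/
noncomputable def nearCount (x : ℕ → ℝ) (k n : ℕ) (a : ℝ) : ℕ :=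
  ((Finset.range n).filter
    fun i => orderStat x k n - a < x i ∧ x i < orderStat x k n).card

/-- A random variable is degenerate if it is almost surely constant. -/
def IsDegenerate {Ω : Type*} [MeasurableSpace Ω] (P : Measure Ω) (Y : Ω → ℝ) : Prop :=
  ∃ q : ℝ, ∀ᵐ ω ∂P, Y ω = q

/-- The conditional probability `P(X₁ + a / V > γ | 𝓘^S)`, where `γ` is the right endpoint of the
support of `X₁` and `𝓘^S` is the sigma-field of the events invariant with respect to the
sequence `S = (V X₁, V X₂, …)`. -/
noncomputable def scaledLimit {Ω : Type*} [MeasurableSpace Ω] (P : Measure Ω) (X : ℕ → Ω → ℝ)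
    (V : Ω → ℝ) (a : ℝ) : Ω → ℝ :=
  P[Set.indicator {ω | rightEndpoint P (X 0) < ((X 0 ω + a / V ω : ℝ) : EReal)}
    (fun _ => (1 : ℝ)) | invariantSigma (fun n ω => V ω * X n ω)]

/-! Along almost every path, `M = V * γ` is approached but not attained, where `γ` is the finite
right endpoint and `ν` the law of `X 0`. Ergodicity of `X` gives limiting frequencies `ν (q, ∞)` for
all rational `q` at once, and monotonicity extends them to the path-dependent level `γ - a / V` when
`ν` has no atom there. As `k n / n → 1`, the order statistic tends to `M`, so the window is squeezed
to `(M - a, M)` and the proportion tends to `ν (γ - a / V, ∞)` (`tendsto_nearCount_div`).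

No independence of `V` and `X` is available, so two facts must be read off the stationary path of
`S`. It determines `M` as its limsup, which is shift invariant. Hence `X 0 + a / V > γ` is almost
surely the path event `S 0 + a > limsup S`, whose Birkhoff averages have the limit just found; by
stationarity of `S` that limit is the conditional expectation (`condExp_invariantSigma_ae_eq`).
Likewise the second atom hypothesis passes from index `0` to every index, which excludes atoms at `γ
- a / V`.

Random indices follow from `K / c = (N / c) * (K / N)`, with subsequences for convergence in
probability and Slutsky's theorem for convergence in distribution. -/

/-! ### Pointwise ergodic theorem by a maximal-function argument. -/

section Ergodic

variable {α : Type*}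

/-- The running maximum of `0` and the first `n` Birkhoff sums, in recursive form. -/
noncomputable def birkhoffMax (T : α → α) (g : α → ℝ) : ℕ → α → ℝ
  | 0 => fun _ => 0
  | n + 1 => fun x => max 0 (g x + birkhoffMax T g n (T x))

theorem birkhoffMax_nonneg (T : α → α) (g : α → ℝ) (n : ℕ) (x : α) : 0 ≤ birkhoffMax T g n x := by
  cases n with
  | zero => exact le_rfl
  | succ n => exact le_max_left _ _

theorem birkhoffMax_le_succ (T : α → α) (g : α → ℝ) (n : ℕ) (x : α) :
    birkhoffMax T g n x ≤ birkhoffMax T g (n + 1) x := by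
  induction n generalizing x with
  | zero => exact birkhoffMax_nonneg T g 1 x
  | succ n ih => exact max_le_max le_rfl (add_le_add le_rfl (ih (T x)))

theorem monotone_birkhoffMax (T : α → α) (g : α → ℝ) (x : α) :
    Monotone fun n => birkhoffMax T g n x :=
  monotone_nat_of_le_succ fun n => birkhoffMax_le_succ T g n x

theorem birkhoffSum_le_birkhoffMax (T : α → α) (g : α → ℝ) (n : ℕ) (x : α) :
    birkhoffSum T g n x ≤ birkhoffMax T g n x := by
  induction n generalizing x with
  | zero => simp [birkhoffMax]
  | succ n ih =>
    rw [birkhoffSum_succ']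
    exact (add_le_add le_rfl (ih (T x))).trans (le_max_right _ _)

theorem bddAbove_range_birkhoffSum_comp (T : α → α) (g : α → ℝ) (x : α) :
    BddAbove (Set.range fun n => birkhoffSum T g n (T x)) ↔
      BddAbove (Set.range fun n => birkhoffSum T g n x) := by
  constructor
  · rintro ⟨C, hC⟩
    refine ⟨max 0 (g x + C), ?_⟩
    rintro _ ⟨n, rfl⟩
    cases n with
    | zero => simp
    | succ n =>
      have := hC ⟨n, rfl⟩
      simp only [birkhoffSum_succ'] at this ⊢
      exact (add_le_add le_rfl this).trans (le_max_right _ _)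
  · rintro ⟨C, hC⟩
    refine ⟨C - g x, ?_⟩
    rintro _ ⟨n, rfl⟩
    have := hC ⟨n + 1, rfl⟩
    simp only [birkhoffSum_succ'] at this ⊢
    linarith

variable [MeasurableSpace α] {μ : Measure α} {T : α → α} {g : α → ℝ}

theorem integrable_birkhoffMax [IsFiniteMeasure μ] (hT : MeasurePreserving T μ μ)
    (hg : Integrable g μ) (n : ℕ) : Integrable (birkhoffMax T g n) μ := by
  induction n with
  | zero => exact integrable_const 0
  | succ n ih => exact (integrable_const (0 : ℝ)).sup (hg.add (hT.integrable_comp_of_integrable ih))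

theorem measurable_birkhoffSum (hT : Measurable T) (hg : Measurable g) (n : ℕ) :
    Measurable (birkhoffSum T g n) := by
  unfold birkhoffSum
  exact Finset.measurable_sum _ fun i _ => hg.comp (hT.iterate i)

/-- Boundedness is an invariant event, so it has probability 0 or 1. Writing `M n` for the running
maximum, `M (n + 1) - M n ∘ T = max (-M n ∘ T) g` has nonnegative integral, since `M` increases in
`n` and `T` preserves `μ`. If the sums were almost surely unbounded, this would converge to `g`,
dominated by `|g|`, forcing `∫ g ≥ 0`. -/
theorem Ergodic.ae_bddAbove_birkhoffSum [IsProbabilityMeasure μ] (hT : Ergodic T μ)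
    (hgm : Measurable g) (hg : Integrable g μ) (hneg : ∫ x, g x ∂μ < 0) :
    ∀ᵐ x ∂μ, BddAbove (Set.range fun n => birkhoffSum T g n x) := by
  have hmeas : MeasurableSet {x | BddAbove (Set.range fun n => birkhoffSum T g n x)} :=
    measurableSet_bddAbove_range fun n => measurable_birkhoffSum hT.measurable hgm n
  have hinv : T ⁻¹' {x | BddAbove (Set.range fun n => birkhoffSum T g n x)} =
      {x | BddAbove (Set.range fun n => birkhoffSum T g n x)} := by
    ext x
    exact bddAbove_range_birkhoffSum_comp T g x
  rcases hT.toPreErgodic.ae_mem_or_ae_notMem hmeas hinv with h | h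
  · exact h
  exfalso
  have hint : ∀ n, 0 ≤ ∫ x, (birkhoffMax T g (n + 1) x - birkhoffMax T g n (T x)) ∂μ := fun n => by
    have hn := integrable_birkhoffMax hT.toMeasurePreserving hg n
    have hnT : Integrable (fun x => birkhoffMax T g n (T x)) μ :=
      hT.toMeasurePreserving.integrable_comp_of_integrable hn
    rw [integral_sub (integrable_birkhoffMax hT.toMeasurePreserving hg _) hnT]
    have hcomp : ∫ x, birkhoffMax T g n (T x) ∂μ = ∫ x, birkhoffMax T g n x ∂μ := by
      conv_rhs => rw [← hT.toMeasurePreserving.map_eq]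
      rw [integral_map hT.measurable.aemeasurable]
      rw [hT.toMeasurePreserving.map_eq]
      exact hn.aestronglyMeasurable
    rw [hcomp, sub_nonneg]
    exact integral_mono hn (integrable_birkhoffMax hT.toMeasurePreserving hg _)
      fun x => birkhoffMax_le_succ T g n x
  have hform : ∀ n x, birkhoffMax T g (n + 1) x - birkhoffMax T g n (T x) =
      max (-birkhoffMax T g n (T x)) (g x) := fun n x => by
    simp only [birkhoffMax]
    rw [← max_sub_sub_right]
    congr 1 <;> ring
  have hlim : Tendsto (fun n => ∫ x, (birkhoffMax T g (n + 1) x - birkhoffMax T g n (T x)) ∂μ) atTop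
      (𝓝 (∫ x, g x ∂μ)) := by
    refine tendsto_integral_of_dominated_convergence (fun x => |g x|) (fun n => ?_) hg.abs
      (fun n => ae_of_all _ fun x => ?_) ?_
    · exact ((integrable_birkhoffMax hT.toMeasurePreserving hg _).sub
        (hT.toMeasurePreserving.integrable_comp_of_integrable
          (integrable_birkhoffMax hT.toMeasurePreserving hg n))).aestronglyMeasurable
    · rw [hform, Real.norm_eq_abs, abs_le]
      have := birkhoffMax_nonneg T g n (T x)
      refine ⟨(neg_abs_le _).trans (le_max_right _ _), max_le ?_ (le_abs_self _)⟩
      linarith [abs_nonneg (g x)]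
    · filter_upwards [h] with x hx
      have hTx : ¬ BddAbove (Set.range fun n => birkhoffSum T g n (T x)) := fun hb =>
        hx ((bddAbove_range_birkhoffSum_comp T g x).1 hb)
      -- Once the running maximum at `T x` exceeds `-g x`, the maximum in `hform` equals `g x`.
      obtain ⟨_, ⟨m, rfl⟩, hm⟩ := not_bddAbove_iff.1 hTx (-g x)
      refine tendsto_const_nhds.congr' ?_
      filter_upwards [eventually_ge_atTop m] with n hn
      have h1 := monotone_birkhoffMax T g (T x) hn
      have h2 := birkhoffSum_le_birkhoffMax T g m (T x)
      simp only at hm h1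
      rw [hform, max_eq_right (by linarith)]
  exact absurd (ge_of_tendsto' hlim hint) (not_le.2 hneg)

/-- For `d` strictly between `∫ g` and `c`, the sums of `g - d` are bounded by some `C`, so the
averages are at most `C / n + d`. -/
theorem Ergodic.ae_eventually_birkhoffAverage_le [IsProbabilityMeasure μ] (hT : Ergodic T μ)
    (hgm : Measurable g) (hg : Integrable g μ) {c : ℝ} (hc : ∫ x, g x ∂μ < c) :
    ∀ᵐ x ∂μ, ∀ᶠ n in atTop, birkhoffAverage ℝ T g n x < c := by
  obtain ⟨d, hd, hdc⟩ := exists_between hc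
  have hneg : ∫ x, (g x - d) ∂μ < 0 := by
    rw [integral_sub hg (integrable_const _)]
    simpa using hd
  filter_upwards [hT.ae_bddAbove_birkhoffSum (hgm.sub_const d) (hg.sub (integrable_const _)) hneg]
    with x hx
  obtain ⟨C, hC⟩ := hx
  have hlim : Tendsto (fun n : ℕ => C / n + d) atTop (𝓝 (0 + d)) :=
    (tendsto_const_nhds.div_atTop tendsto_natCast_atTop_atTop).add_const d
  rw [zero_add] at hlim
  filter_upwards [hlim.eventually_lt_const hdc, eventually_gt_atTop 0] with n hn hn0
  refine lt_of_le_of_lt ?_ hn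
  have hn0' : (0 : ℝ) < n := by exact_mod_cast hn0
  have h1 := hC ⟨n, rfl⟩
  simp only [birkhoffSum, Finset.sum_sub_distrib, Finset.sum_const, Finset.card_range,
    nsmul_eq_mul] at h1
  rw [birkhoffAverage, birkhoffSum, smul_eq_mul, inv_mul_eq_div, div_le_iff₀ hn0', add_mul,
    div_mul_cancel₀ _ hn0'.ne']
  linarith

/-- The pointwise ergodic theorem for an ergodic transformation. -/
theorem Ergodic.ae_tendsto_birkhoffAverage [IsProbabilityMeasure μ] (hT : Ergodic T μ)
    (hgm : Measurable g) (hg : Integrable g μ) :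
    ∀ᵐ x ∂μ, Tendsto (fun n => birkhoffAverage ℝ T g n x) atTop (𝓝 (∫ x, g x ∂μ)) := by
  have hup : ∀ᵐ x ∂μ, ∀ q : ℚ, ∫ x, g x ∂μ < q → ∀ᶠ n in atTop, birkhoffAverage ℝ T g n x < q := by
    rw [ae_all_iff]
    intro q
    by_cases hq : ∫ x, g x ∂μ < q
    · filter_upwards [hT.ae_eventually_birkhoffAverage_le hgm hg hq] with x hx _ using hx
    · exact ae_of_all _ fun x h => absurd h hq
  have hlo : ∀ᵐ x ∂μ, ∀ q : ℚ, q < ∫ x, g x ∂μ → ∀ᶠ n in atTop, q < birkhoffAverage ℝ T g n x := by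
    rw [ae_all_iff]
    intro q
    by_cases hq : q < ∫ x, g x ∂μ
    · have hq' : ∫ x, (-g) x ∂μ < -(q : ℝ) := by
        simp only [Pi.neg_apply, integral_neg]
        linarith
      filter_upwards [hT.ae_eventually_birkhoffAverage_le hgm.neg hg.neg hq'] with x hx _
      filter_upwards [hx] with n hn
      simp only [birkhoffAverage, birkhoffSum, Pi.neg_apply, Finset.sum_neg_distrib, smul_neg,
        neg_lt_neg_iff] at hn
      exact hn
    · exact ae_of_all _ fun x h => absurd h hq
  filter_upwards [hup, hlo] with x h1 h2
  rw [tendsto_order]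
  refine ⟨fun b hb => ?_, fun b hb => ?_⟩
  · obtain ⟨q, hq1, hq2⟩ := exists_rat_btwn hb
    filter_upwards [h2 q hq2] with n hn using hq1.trans hn
  · obtain ⟨q, hq1, hq2⟩ := exists_rat_btwn hb
    filter_upwards [h1 q hq1] with n hn using hn.trans hq2

end Ergodic

/-! ### Deterministic counting for a single sequence. -/

section Counting

/-- The proportion of the first `n` terms of the sequence `x` that lie in `C`. -/
noncomputable def visitFreq (C : Set ℝ) (x : ℕ → ℝ) (n : ℕ) : ℝ :=
  (∑ i ∈ Finset.range n, C.indicator (fun _ => (1 : ℝ)) (x i)) / n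

theorem visitFreq_mono {C D : Set ℝ} (h : C ⊆ D) (x : ℕ → ℝ) (n : ℕ) :
    visitFreq C x n ≤ visitFreq D x n := by
  unfold visitFreq
  gcongr with i

theorem visitFreq_le_add {C D E : Set ℝ} (h : C ⊆ D ∪ E) (x : ℕ → ℝ) (n : ℕ) :
    visitFreq C x n ≤ visitFreq D x n + visitFreq E x n := by
  unfold visitFreq
  rw [← add_div, ← Finset.sum_add_distrib]
  gcongr with i
  by_cases hC : x i ∈ C
  · rcases h hC with hD | hE
    · rw [Set.indicator_of_mem hC, Set.indicator_of_mem hD]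
      have : 0 ≤ E.indicator (fun _ => (1 : ℝ)) (x i) :=
        Set.indicator_nonneg (fun _ _ => zero_le_one) _
      linarith
    · rw [Set.indicator_of_mem hC, Set.indicator_of_mem hE]
      have : 0 ≤ D.indicator (fun _ => (1 : ℝ)) (x i) :=
        Set.indicator_nonneg (fun _ _ => zero_le_one) _
      linarith
  · rw [Set.indicator_of_notMem hC]
    exact add_nonneg (Set.indicator_nonneg (fun _ _ => zero_le_one) _)
      (Set.indicator_nonneg (fun _ _ => zero_le_one) _)

theorem visitFreq_Ioi_mul {v : ℝ} (hv : 0 < v) (y : ℝ) (x : ℕ → ℝ) (n : ℕ) :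
    visitFreq (Set.Ioi (v * y)) (fun i => v * x i) n = visitFreq (Set.Ioi y) x n := by
  unfold visitFreq
  congr 1
  refine Finset.sum_congr rfl fun i _ => ?_
  simp only [Set.indicator_apply, Set.mem_Ioi, mul_lt_mul_iff_right₀ hv]

theorem birkhoffAverage_seqShift_eval (C : Set ℝ) (x : ℕ → ℝ) (n : ℕ) :
    birkhoffAverage ℝ seqShift (fun s => C.indicator (fun _ => (1 : ℝ)) (s 0)) n x =
      visitFreq C x n := by
  have hit : ∀ i, (seqShift^[i] x) 0 = x i := by
    intro i
    induction i generalizing x with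
    | zero => rfl
    | succ i ih => rw [Function.iterate_succ_apply, ih]; rfl
  simp only [birkhoffAverage, birkhoffSum, visitFreq, smul_eq_mul, inv_mul_eq_div, hit]

theorem nearCount_div (x : ℕ → ℝ) (k n : ℕ) (a : ℝ) :
    (nearCount x k n a : ℝ) / n =
      visitFreq (Set.Ioo (orderStat x k n - a) (orderStat x k n)) x n := by
  unfold nearCount visitFreq
  rw [Finset.card_filter]
  push_cast
  simp only [Set.indicator_apply, Set.mem_Ioo]

theorem orderStat_le_iff (x : ℕ → ℝ) {k n : ℕ} (h : 1 ≤ k ∧ k ≤ n) (y : ℝ) :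
    orderStat x k n ≤ y ↔ k ≤ ((Finset.range n).filter fun i => x i ≤ y).card := by
  rw [orderStat, dif_pos h]
  have hcard : ((Finset.range n).filter fun i => x i ≤ y).card =
      (Finset.univ.filter fun i : Fin n =>
        ((fun i : Fin n => x i) ∘ Tuple.sort fun i : Fin n => x i) i ≤ y).card := by
    rw [Finset.card_filter, Finset.card_filter]
    simp only [Function.comp_apply]
    rw [Equiv.sum_comp (Tuple.sort fun i : Fin n => x i) fun i : Fin n => if x i ≤ y then 1 else 0]
    exact (Fin.sum_univ_eq_sum_range (fun i => if x i ≤ y then 1 else 0) n).symm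
  -- Rank `k` sits at index `k - 1`; as `1 ≤ k`, `k - 1 < card` means `k ≤ card`.
  have := Tuple.lt_card_le_iff_apply_le_of_monotone (j := (⟨k - 1, by omega⟩ : Fin n)) (a := y)
    (Tuple.monotone_sort fun i : Fin n => x i)
  rw [hcard]
  simp only [Function.comp_apply] at this ⊢
  rw [← this]
  omega

theorem orderStat_lt (x : ℕ → ℝ) {k n : ℕ} (h : 1 ≤ k ∧ k ≤ n) {M : ℝ} (hM : ∀ i, x i < M) :
    orderStat x k n < M := by
  rw [orderStat, dif_pos h]
  exact hM _

/-- At least `k` terms are at most `y`, leaving at most `n - k` above. With `k / n → 1`, this pushes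
the order statistic above every level exceeded with positive frequency. -/
theorem visitFreq_Ioi_le_of_orderStat_le (x : ℕ → ℝ) {k n : ℕ} (h : 1 ≤ k ∧ k ≤ n) {y : ℝ}
    (hy : orderStat x k n ≤ y) : visitFreq (Set.Ioi y) x n ≤ 1 - (k : ℝ) / n := by
  have hn : (0 : ℝ) < n := by exact_mod_cast (by omega : 0 < n)
  have h1 : (k : ℝ) ≤ ((Finset.range n).filter fun i => x i ≤ y).card := by
    exact_mod_cast (orderStat_le_iff x h y).1 hy
  have h2 : (∑ i ∈ Finset.range n, (Set.Ioi y).indicator (fun _ => (1 : ℝ)) (x i)) +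
      ((Finset.range n).filter fun i => x i ≤ y).card = n := by
    rw [Finset.card_filter]
    push_cast
    rw [← Finset.sum_add_distrib]
    calc _ = ∑ i ∈ Finset.range n, (1 : ℝ) := Finset.sum_congr rfl fun i _ => by
          by_cases hi : x i ≤ y
          · simp [hi]
          · simp [hi, not_le.1 hi]
      _ = n := by simp
  rw [visitFreq, div_le_iff₀ hn, sub_mul, div_mul_cancel₀ _ hn.ne']
  linarith

theorem measurable_orderStat (k n : ℕ) : Measurable fun x : ℕ → ℝ => orderStat x k n := by
  by_cases h : 1 ≤ k ∧ k ≤ n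
  · refine measurable_of_Iic fun y => ?_
    have : (fun x : ℕ → ℝ => orderStat x k n) ⁻¹' Set.Iic y =
        {x | k ≤ ∑ i ∈ Finset.range n, if x i ≤ y then 1 else 0} := by
      ext x
      rw [Set.mem_preimage, Set.mem_Iic, orderStat_le_iff x h, Finset.card_filter]
      rfl
    rw [this]
    refine measurableSet_le measurable_const (Finset.measurable_sum _ fun i _ => ?_)
    exact Measurable.ite (measurableSet_le (measurable_pi_apply i) measurable_const)
      measurable_const measurable_const
  · simp only [orderStat, dif_neg h]
    exact measurable_const

theorem measurable_nearCount (k n : ℕ) (a : ℝ) : Measurable fun x : ℕ → ℝ => nearCount x k n a := by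
  simp only [nearCount, Finset.card_filter]
  refine Finset.measurable_sum _ fun i _ => ?_
  have h := measurable_orderStat k n
  refine Measurable.ite (MeasurableSet.inter ?_ ?_) measurable_const measurable_const
  · exact measurableSet_lt (h.sub_const a) (measurable_pi_apply i)
  · exact measurableSet_lt (measurable_pi_apply i) h

theorem measurable_nearCount_random {Ω : Type*} [MeasurableSpace Ω] {S : ℕ → Ω → ℝ}
    (hS : ∀ n, Measurable (S n)) {N : Ω → ℕ} (hN : Measurable N) (k : ℕ → ℕ) (a : ℝ) :
    Measurable fun ω => nearCount (fun i => S i ω) (k (N ω)) (N ω) a := by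
  have h : Measurable fun p : ℕ × Ω => nearCount (fun i => S i p.2) (k p.1) p.1 a :=
    measurable_from_prod_countable_right fun n =>
      (measurable_nearCount (k n) n a).comp (measurable_pi_lambda _ hS)
  exact h.comp (hN.prodMk measurable_id)

/-- If the order statistics of ranks `k n ~ n` approach the upper bound `M` of the sequence `x`, and
the limiting empirical tail is continuous at `M` and at `M - a`, then the proportion of near order
statistics converges to the limiting empirical tail at `M - a`. -/
theorem tendsto_nearCount_div {x : ℕ → ℝ} {M a ℓ : ℝ} {k : ℕ → ℕ}
    (hk : ∀ n, 1 ≤ n → 1 ≤ k n ∧ k n ≤ n)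
    (hklim : Tendsto (fun n => (k n : ℝ) / n) atTop (𝓝 1))
    (hM : ∀ i, x i < M)
    (hpos : ∀ δ > 0, ∃ p > 0, ∀ᶠ n in atTop, p ≤ visitFreq (Set.Ioi (M - δ)) x n)
    (hsmall : ∀ ε > 0, ∃ δ > 0, ∀ᶠ n in atTop, visitFreq (Set.Ioi (M - δ)) x n ≤ ε)
    (hlim : Tendsto (visitFreq (Set.Ioi (M - a)) x) atTop (𝓝 ℓ))
    (hleft : ∀ ε > 0, ∃ δ > 0, ∀ᶠ n in atTop, visitFreq (Set.Ioi (M - a - δ)) x n ≤ ℓ + ε) :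
    Tendsto (fun n => (nearCount x (k n) n a : ℝ) / n) atTop (𝓝 ℓ) := by
  have hord : ∀ δ > 0, ∀ᶠ n in atTop, M - δ < orderStat x (k n) n := by
    intro δ hδ
    obtain ⟨p, hp, hev⟩ := hpos δ hδ
    filter_upwards [hev, hklim.eventually_const_lt (show 1 - p < 1 by linarith),
      eventually_ge_atTop 1] with n h1 h2 hn
    by_contra! hle
    have := visitFreq_Ioi_le_of_orderStat_le x (hk n hn) hle
    linarith
  rw [tendsto_order]
  constructor
  · intro b hb
    obtain ⟨δ, hδ, hev⟩ := hsmall ((ℓ - b) / 2) (by linarith)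
    filter_upwards [hev, hord δ hδ, hlim.eventually_const_lt (show (ℓ + b) / 2 < ℓ by linarith),
      eventually_ge_atTop 1] with n h1 h2 h3 hn
    have hT := orderStat_lt x (hk n hn) hM
    -- A term above `M - a` lies in the window if it is below the order statistic; otherwise it
    -- exceeds `M - δ`, which is rare by `hsmall`.
    have := visitFreq_le_add (C := Set.Ioi (M - a))
      (D := Set.Ioo (orderStat x (k n) n - a) (orderStat x (k n) n)) (E := Set.Ioi (M - δ))
      (fun y hy => by
        rw [Set.mem_Ioi] at hy
        by_cases h : y < orderStat x (k n) n
        · exact Or.inl ⟨by linarith, h⟩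
        · exact Or.inr (Set.mem_Ioi.2 (by linarith))) x n
    rw [nearCount_div]
    linarith
  · intro b hb
    obtain ⟨δ, hδ, hev⟩ := hleft ((b - ℓ) / 2) (by linarith)
    filter_upwards [hev, hord δ hδ] with n h1 h2
    have := visitFreq_mono (C := Set.Ioo (orderStat x (k n) n - a) (orderStat x (k n) n))
      (D := Set.Ioi (M - a - δ)) (fun y hy => Set.mem_Ioi.2 (by linarith [hy.1])) x n
    rw [nearCount_div]
    linarith

theorem frequently_of_visitFreq_Ioi {x : ℕ → ℝ} {y p : ℝ} (hp : 0 < p)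
    (h : ∀ᶠ n in atTop, p ≤ visitFreq (Set.Ioi y) x n) : ∃ᶠ i in atTop, y < x i := by
  intro hev
  obtain ⟨m, hm⟩ := eventually_atTop.1 hev
  have hlim : Tendsto (fun n : ℕ => (m : ℝ) / n) atTop (𝓝 0) :=
    tendsto_const_nhds.div_atTop tendsto_natCast_atTop_atTop
  obtain ⟨n, h1, h2, hn⟩ :=
    (h.and ((hlim.eventually_lt_const hp).and (eventually_ge_atTop m))).exists
  refine absurd (h1.trans ?_) (not_le.2 h2)
  unfold visitFreq
  gcongr
  calc ∑ i ∈ Finset.range n, (Set.Ioi y).indicator (fun _ => (1 : ℝ)) (x i)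
      ≤ ∑ i ∈ Finset.range n, if i < m then (1 : ℝ) else 0 := by
        refine Finset.sum_le_sum fun i _ => ?_
        by_cases hi : i < m
        · rw [if_pos hi]
          exact Set.indicator_le_self' (fun _ _ => zero_le_one) _
        · rw [if_neg hi, Set.indicator_of_notMem]
          exact hm i (not_lt.1 hi)
    _ ≤ m := by
        rw [← Finset.sum_filter, Finset.sum_const, nsmul_eq_mul, mul_one]
        have : (Finset.range n).filter (fun i => i < m) ⊆ Finset.range m := fun i hi =>
          Finset.mem_range.2 (Finset.mem_filter.1 hi).2
        exact_mod_cast (Finset.card_le_card this).trans (Finset.card_range m).le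

/-- This recovers the bound from the sequence alone, as a shift-invariant functional. -/
theorem limsup_coe_eq {x : ℕ → ℝ} {M : ℝ} (hM : ∀ i, x i < M)
    (hpos : ∀ δ > 0, ∃ p > 0, ∀ᶠ n in atTop, p ≤ visitFreq (Set.Ioi (M - δ)) x n) :
    limsup (fun i => (x i : EReal)) atTop = M := by
  refine le_antisymm ?_ ?_
  · refine limsup_le_of_le (h := Eventually.of_forall fun i => ?_)
    exact_mod_cast (hM i).le
  · refine le_of_forall_lt fun c hc => ?_
    obtain ⟨y, hcy, hyM⟩ := EReal.lt_iff_exists_real_btwn.1 hc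
    rw [EReal.coe_lt_coe_iff] at hyM
    obtain ⟨p, hp, h⟩ := hpos (M - y) (by linarith)
    rw [sub_sub_cancel] at h
    refine hcy.trans_le (le_limsup_of_frequently_le ?_)
    exact (frequently_of_visitFreq_Ioi hp h).mono fun i hi => by exact_mod_cast hi.le

end Counting

/-! ### From rational thresholds to arbitrary continuity points. -/

section EmpiricalTail

variable {ν : Measure ℝ} {x : ℕ → ℝ}

theorem exists_pos_eventually_le_visitFreq_Ioi
    (hx : ∀ q : ℚ, Tendsto (visitFreq (Set.Ioi (q : ℝ)) x) atTop (𝓝 (ν.real (Set.Ioi (q : ℝ)))))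
    {y z : ℝ} (hyz : y < z) (hz : ∀ r < z, 0 < ν.real (Set.Ioi r)) :
    ∃ p > 0, ∀ᶠ n in atTop, p ≤ visitFreq (Set.Ioi y) x n := by
  obtain ⟨q, hyq, hqz⟩ := exists_rat_btwn hyz
  have hpos := hz q hqz
  refine ⟨ν.real (Set.Ioi (q : ℝ)) / 2, half_pos hpos, ?_⟩
  filter_upwards [(hx q).eventually_const_lt (half_lt_self hpos)] with n hn
  exact hn.le.trans (visitFreq_mono (Set.Ioi_subset_Ioi hyq.le) x n)

variable [IsProbabilityMeasure ν]

theorem continuousAt_measureReal_Ioi {y : ℝ} (hy : ν {y} = 0) :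
    ContinuousAt (fun z => ν.real (Set.Ioi z)) y := by
  have hcdf : ContinuousAt (cdf ν) y := by
    refine continuousAt_iff_continuous_left'_right'.2 ⟨?_, ?_⟩
    · rw [(monotone_cdf ν).continuousWithinAt_Iio_iff_leftLim_eq]
      have h := (cdf ν).measure_singleton y
      rw [measure_cdf, hy, eq_comm, ENNReal.ofReal_eq_zero] at h
      exact le_antisymm ((monotone_cdf ν).leftLim_le le_rfl) (by linarith)
    · exact ((cdf ν).right_continuous y).mono Set.Ioi_subset_Ici_self
  have : (fun z => ν.real (Set.Ioi z)) = fun z => 1 - cdf ν z := by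
    ext z
    rw [cdf_eq_real, ← Set.compl_Iic, probReal_compl_eq_one_sub measurableSet_Iic]
  rw [this]
  exact continuousAt_const.sub hcdf

theorem exists_rat_lt_measureReal_Ioi_lt {y ε : ℝ} (hy : ν {y} = 0) (hε : 0 < ε) :
    ∃ q : ℚ, q < y ∧ ν.real (Set.Ioi (q : ℝ)) < ν.real (Set.Ioi y) + ε := by
  have h := (continuousAt_measureReal_Ioi hy).eventually_lt_const
    (show ν.real (Set.Ioi y) < ν.real (Set.Ioi y) + ε by linarith)
  obtain ⟨δ, hδ, hb⟩ := Metric.eventually_nhds_iff.1 h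
  obtain ⟨q, h1, h2⟩ := exists_rat_btwn (show y - δ < y by linarith)
  exact ⟨q, h2, hb (by rw [Real.dist_eq, abs_lt]; constructor <;> linarith)⟩

theorem exists_rat_gt_lt_measureReal_Ioi {y ε : ℝ} (hy : ν {y} = 0) (hε : 0 < ε) :
    ∃ q : ℚ, y < q ∧ ν.real (Set.Ioi y) - ε < ν.real (Set.Ioi (q : ℝ)) := by
  have h := (continuousAt_measureReal_Ioi hy).eventually_const_lt
    (show ν.real (Set.Ioi y) - ε < ν.real (Set.Ioi y) by linarith)
  obtain ⟨δ, hδ, hb⟩ := Metric.eventually_nhds_iff.1 h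
  obtain ⟨q, h1, h2⟩ := exists_rat_btwn (show y < y + δ by linarith)
  exact ⟨q, h1, hb (by rw [Real.dist_eq, abs_lt]; constructor <;> linarith)⟩

/-- Squeeze between rational thresholds near `y`. Since `hx` does not mention `y`, one null set
serves all levels, including path-dependent ones. -/
theorem tendsto_visitFreq_Ioi
    (hx : ∀ q : ℚ, Tendsto (visitFreq (Set.Ioi (q : ℝ)) x) atTop (𝓝 (ν.real (Set.Ioi (q : ℝ)))))
    {y : ℝ} (hy : ν {y} = 0) :
    Tendsto (visitFreq (Set.Ioi y) x) atTop (𝓝 (ν.real (Set.Ioi y))) := by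
  rw [tendsto_order]
  refine ⟨fun b hb => ?_, fun b hb => ?_⟩
  · obtain ⟨q, hq, hqb⟩ := exists_rat_gt_lt_measureReal_Ioi hy (sub_pos.2 hb)
    filter_upwards [(hx q).eventually_const_lt (show b < ν.real (Set.Ioi (q : ℝ)) by linarith)]
      with n hn
    exact hn.trans_le (visitFreq_mono (Set.Ioi_subset_Ioi hq.le) x n)
  · obtain ⟨q, hq, hqb⟩ := exists_rat_lt_measureReal_Ioi_lt hy (sub_pos.2 hb)
    filter_upwards [(hx q).eventually_lt_const (show ν.real (Set.Ioi (q : ℝ)) < b by linarith)]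
      with n hn
    exact (visitFreq_mono (Set.Ioi_subset_Ioi hq.le) x n).trans_lt hn

theorem exists_pos_eventually_visitFreq_Ioi_le
    (hx : ∀ q : ℚ, Tendsto (visitFreq (Set.Ioi (q : ℝ)) x) atTop (𝓝 (ν.real (Set.Ioi (q : ℝ)))))
    {y ε : ℝ} (hy : ν {y} = 0) (hε : 0 < ε) :
    ∃ δ > 0, ∀ᶠ n in atTop, visitFreq (Set.Ioi (y - δ)) x n ≤ ν.real (Set.Ioi y) + ε := by
  obtain ⟨q, hq, hqb⟩ := exists_rat_lt_measureReal_Ioi_lt hy hε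
  refine ⟨y - q, by linarith, ?_⟩
  rw [sub_sub_cancel]
  filter_upwards [(hx q).eventually_lt_const hqb] with n hn using hn.le

end EmpiricalTail

/-! ### Right endpoint, invariant sigma-field and conditional expectation. -/

section Stationary

variable {Ω : Type*} [MeasurableSpace Ω] {P : Measure Ω}

theorem exists_real_eq_rightEndpoint [IsProbabilityMeasure P] {Y : Ω → ℝ} (hY : Measurable Y)
    (h : rightEndpoint P Y < ⊤) :
    ∃ γ : ℝ, rightEndpoint P Y = γ ∧ (∀ r < γ, 0 < (P.map Y).real (Set.Ioi r)) ∧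
      P.map Y (Set.Ioi γ) = 0 := by
  have : IsProbabilityMeasure (P.map Y) := Measure.isProbabilityMeasure_map hY.aemeasurable
  have htail : ∀ z, (P.map Y).real (Set.Ioi z) = 1 - cdf (P.map Y) z := fun z => by
    rw [cdf_eq_real, ← Set.compl_Iic, probReal_compl_eq_one_sub measurableSet_Iic]
  have hle : ∀ x : ℝ, cdf (P.map Y) x < 1 → (x : EReal) ≤ rightEndpoint P Y := fun x hx =>
    le_sSup ⟨x, hx, rfl⟩
  obtain ⟨x₀, hx₀⟩ := ((tendsto_cdf_atBot (P.map Y)).eventually_lt_const one_pos).exists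
  have hbot : rightEndpoint P Y ≠ ⊥ := fun hb => by
    have := hle x₀ hx₀
    rw [hb, le_bot_iff] at this
    exact EReal.coe_ne_bot _ this
  obtain ⟨γ, hγ⟩ : ∃ γ : ℝ, rightEndpoint P Y = γ :=
    ⟨_, (EReal.coe_toReal h.ne hbot).symm⟩
  refine ⟨γ, hγ, fun r hr => ?_, ?_⟩
  · have hr' : (r : EReal) < rightEndpoint P Y := by
      rw [hγ]
      exact_mod_cast hr
    obtain ⟨_, ⟨x, hx, rfl⟩, hrx⟩ := lt_sSup_iff.1 hr'
    have hrx' : r < x := EReal.coe_lt_coe_iff.1 hrx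
    have hx' : cdf (P.map Y) x < 1 := hx
    rw [htail]
    linarith [monotone_cdf (P.map Y) hrx'.le]
  · have hzero : ∀ q : ℚ, γ < q → P.map Y (Set.Ioi (q : ℝ)) = 0 := fun q hq => by
      have h1 : ¬ cdf (P.map Y) q < 1 := fun h1 => by
        have := hle q h1
        rw [hγ, EReal.coe_le_coe_iff] at this
        linarith
      have h2 := htail q
      have h3 : (P.map Y).real (Set.Ioi (q : ℝ)) = 0 :=
        le_antisymm (by linarith [not_lt.1 h1]) measureReal_nonneg
      exact (measureReal_eq_zero_iff (measure_ne_top _ _)).1 h3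
    refine measure_mono_null (t := ⋃ q : ℚ, ⋃ _ : γ < q, Set.Ioi (q : ℝ)) (fun x hx => ?_) ?_
    · obtain ⟨q, h1, h2⟩ := exists_rat_btwn (Set.mem_Ioi.1 hx)
      exact Set.mem_iUnion₂.2 ⟨q, h1, h2⟩
    · exact measure_iUnion_null fun q => measure_iUnion_null fun hq => hzero q hq

theorem seqShift_iterate (x : ℕ → ℝ) (i : ℕ) : seqShift^[i] x = fun n => x (i + n) := by
  induction i generalizing x with
  | zero => simp
  | succ i ih =>
    rw [Function.iterate_succ_apply, ih]
    ext n
    simp only [seqShift]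
    congr 1
    omega

theorem measurable_seqShift : Measurable seqShift :=
  measurable_pi_lambda _ fun n => measurable_pi_apply (n + 1)

variable {S : ℕ → Ω → ℝ}

theorem invariantSigma_le (hS : ∀ n, Measurable (S n)) :
    invariantSigma S ≤ ‹MeasurableSpace Ω› := by
  rintro A ⟨B, hB, h⟩
  rw [h 0]
  exact (measurable_pi_lambda _ fun n => hS (0 + n)) hB

theorem IsStrictlyStationary.ae_shift (hS : ∀ n, Measurable (S n)) (hstat : IsStrictlyStationary P S)
    {p : (ℕ → ℝ) → Prop} (hp : MeasurableSet {s | p s}) (h : ∀ᵐ ω ∂P, p fun n => S n ω) (i : ℕ) :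
    ∀ᵐ ω ∂P, p fun n => S (i + n) ω := by
  have hm : Measurable fun ω n => S n ω := measurable_pi_lambda _ hS
  have h1 : ∀ᵐ s ∂seqLaw P S, p s := (ae_map_iff hm.aemeasurable hp).2 h
  have h2 := (MeasurePreserving.iterate hstat i).quasiMeasurePreserving.ae h1
  have h3 := ae_of_ae_map hm.aemeasurable h2
  filter_upwards [h3] with ω hω
  rwa [seqShift_iterate] at hω

/-- If the Birkhoff averages of a bounded function of a stationary sequence converge, then the limit
is the conditional expectation given the invariant sigma-field. -/
theorem condExp_invariantSigma_ae_eq [IsProbabilityMeasure P] (hS : ∀ n, Measurable (S n))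
    (hstat : IsStrictlyStationary P S) {f : (ℕ → ℝ) → ℝ} (hf : Measurable f) (hb : ∀ s, |f s| ≤ 1)
    {h : Ω → ℝ}
    (hlim : ∀ᵐ ω ∂P, Tendsto (fun n => birkhoffAverage ℝ seqShift f n fun i => S i ω) atTop
      (𝓝 (h ω))) :
    P[fun ω => f fun i => S i ω | invariantSigma S] =ᵐ[P] h := by
  have hm : Measurable fun ω n => S n ω := measurable_pi_lambda _ hS
  have hfm : ∀ n, Measurable (birkhoffAverage ℝ seqShift f n) := fun n =>
    (measurable_birkhoffSum measurable_seqShift hf n).const_smul ((n : ℝ)⁻¹)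
  have hbA : ∀ n s, |birkhoffAverage ℝ seqShift f n s| ≤ 1 := fun n s => by
    rw [birkhoffAverage, birkhoffSum, smul_eq_mul, inv_mul_eq_div, abs_div, Nat.abs_cast]
    refine div_le_one_of_le₀ ((Finset.abs_sum_le_sum_abs _ _).trans ?_) (Nat.cast_nonneg _)
    exact (Finset.sum_le_sum fun i _ => hb _).trans (by simp)
  have hint : ∀ {F : (ℕ → ℝ) → ℝ}, Measurable F → (∀ s, |F s| ≤ 1) →
      Integrable (fun ω => F fun i => S i ω) P := fun hF hF1 =>
    Integrable.of_bound (hF.comp hm).aestronglyMeasurable 1 (ae_of_all _ fun ω => hF1 _)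
  -- The limit is taken as a total function so that it is shift invariant everywhere:
  -- `invariantSigma` demands exact equality of events, not equality up to null sets.
  set Φ : (ℕ → ℝ) → ℝ := fun s => limUnder atTop fun n => birkhoffAverage ℝ seqShift f n s with hΦ
  have hΦm : Measurable Φ :=
    (StronglyMeasurable.limUnder fun n => (hfm n).stronglyMeasurable).measurable
  have hconv : ∀ s L, Tendsto (fun n => birkhoffAverage ℝ seqShift f n (seqShift s)) atTop (𝓝 L) ↔
      Tendsto (fun n => birkhoffAverage ℝ seqShift f n s) atTop (𝓝 L) := fun s L => by
    have hd := tendsto_birkhoffAverage_apply_sub_birkhoffAverage' ℝ (g := f)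
      (isBounded_iff_forall_norm_le.2 ⟨1, by rintro _ ⟨s, rfl⟩; exact hb s⟩) seqShift s
    constructor
    · intro h1
      simpa using h1.sub hd
    · intro h1
      simpa using h1.add hd
  have hΦinv : ∀ s, Φ (seqShift s) = Φ s := fun s => by
    by_cases hs : ∃ L, Tendsto (fun n => birkhoffAverage ℝ seqShift f n s) atTop (𝓝 L)
    · obtain ⟨L, hL⟩ := hs
      exact ((hconv s L).2 hL).limUnder_eq.trans hL.limUnder_eq.symm
    · have hs' : ¬ ∃ L, Tendsto (fun n => birkhoffAverage ℝ seqShift f n (seqShift s)) atTop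
          (𝓝 L) := fun ⟨L, hL⟩ => hs ⟨L, (hconv s L).1 hL⟩
      simp only [hΦ]
      -- Without convergence both sides take the same default value.
      rw [limUnder_of_not_tendsto hs, limUnder_of_not_tendsto hs']
  have hΦinv' : ∀ s i, Φ (seqShift^[i] s) = Φ s := fun s i => by
    induction i with
    | zero => rfl
    | succ i ih => rw [Function.iterate_succ_apply', hΦinv, ih]
  have hhΦ : h =ᵐ[P] fun ω => Φ fun n => S n ω := by
    filter_upwards [hlim] with ω hω using hω.limUnder_eq.symm
  have hΦI : Measurable[invariantSigma S] fun ω => Φ fun n => S n ω := fun C hC =>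
    ⟨Φ ⁻¹' C, hΦm hC, fun i => by
      ext ω
      have := hΦinv' (fun n => S n ω) i
      rw [seqShift_iterate] at this
      change Φ (fun n => S n ω) ∈ C ↔ Φ (fun n => S (i + n) ω) ∈ C
      rw [this]⟩
  have hbh : ∀ᵐ ω ∂P, ‖h ω‖ ≤ 1 := by
    filter_upwards [hlim] with ω hω
    exact le_of_tendsto' hω.norm fun n => hbA n _
  have hhint : Integrable h P :=
    Integrable.of_bound ((hΦm.comp hm).aestronglyMeasurable.congr hhΦ.symm) 1 hbh
  refine (ae_eq_condExp_of_forall_setIntegral_eq (invariantSigma_le hS) (hint hf hb)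
    (fun s _ _ => hhint.integrableOn) (fun A hA _ => ?_)
    ⟨_, hΦI.stronglyMeasurable, hhΦ⟩).symm
  obtain ⟨B, hB, hAB⟩ := hA
  have hAm : MeasurableSet A := invariantSigma_le hS A ⟨B, hB, hAB⟩
  -- The same `B` represents `A` at every shift, so the integral over `A` is that of `B.indicator f`
  -- composed with the shift, and stationarity removes the shift.
  have hshift : ∀ i, ∫ ω in A, f (seqShift^[i] fun n => S n ω) ∂P =
      ∫ ω in A, f (fun n => S n ω) ∂P := fun i => by
    have hlaw : ∀ j, ∫ ω in A, f (seqShift^[j] fun n => S n ω) ∂P =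
        ∫ s, B.indicator f (seqShift^[j] s) ∂seqLaw P S := fun j => by
      rw [seqLaw, integral_map (f := fun s => B.indicator f (seqShift^[j] s)) hm.aemeasurable
        ((hf.indicator hB).comp (measurable_seqShift.iterate j)).aestronglyMeasurable,
        ← integral_indicator hAm]
      refine integral_congr_ae (ae_of_all _ fun ω => ?_)
      have hmem : ω ∈ A ↔ (seqShift^[j] fun n => S n ω) ∈ B := by
        rw [seqShift_iterate]
        conv_lhs => rw [hAB j]
        rfl
      by_cases hω : ω ∈ A
      · simp only [Set.indicator_of_mem hω, Set.indicator_of_mem (hmem.1 hω)]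
      · simp only [Set.indicator_of_notMem hω, Set.indicator_of_notMem (mt hmem.2 hω)]
    have hpres := MeasurePreserving.iterate hstat i
    have hmap := integral_map (μ := seqLaw P S) hpres.measurable.aemeasurable
      (f := B.indicator f) (hf.indicator hB).aestronglyMeasurable
    rw [hpres.map_eq] at hmap
    rw [hlaw i, ← hmap]
    exact (hlaw 0).symm
  have havg : ∀ n : ℕ, 0 < n → ∫ ω in A, birkhoffAverage ℝ seqShift f n (fun i => S i ω) ∂P =
      ∫ ω in A, f (fun n => S n ω) ∂P := fun n hn => by
    have hI : ∀ i, IntegrableOn (fun ω => f (seqShift^[i] fun n => S n ω)) A P := fun i =>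
      (hint (hf.comp (measurable_seqShift.iterate i)) fun s => hb _).integrableOn
    simp only [birkhoffAverage, birkhoffSum]
    rw [integral_smul, integral_finsetSum _ fun i _ => hI i,
      Finset.sum_congr rfl fun i _ => hshift i, Finset.sum_const, Finset.card_range, nsmul_eq_mul,
      smul_eq_mul, inv_mul_cancel_left₀ (by exact_mod_cast hn.ne')]
  have hDCT : Tendsto (fun n => ∫ ω in A, birkhoffAverage ℝ seqShift f n (fun i => S i ω) ∂P) atTop
      (𝓝 (∫ ω in A, h ω ∂P)) :=
    tendsto_integral_of_dominated_convergence (fun _ => 1)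
      (fun n => ((hfm n).comp hm).aestronglyMeasurable) (integrable_const 1)
      (fun n => ae_of_all _ fun ω => hbA n _) (ae_restrict_of_ae hlim)
  refine tendsto_nhds_unique hDCT (tendsto_const_nhds.congr' ?_)
  filter_upwards [eventually_gt_atTop 0] with n hn using (havg n hn).symm

/-- The empirical frequencies of an ergodic sequence converge to the marginal law. -/
theorem IsStationaryErgodic.ae_tendsto_visitFreq [IsProbabilityMeasure P] {X : ℕ → Ω → ℝ}
    (hX : ∀ n, Measurable (X n)) (hXerg : IsStationaryErgodic P X) {C : Set ℝ}
    (hC : MeasurableSet C) :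
    ∀ᵐ ω ∂P, Tendsto (visitFreq C fun i => X i ω) atTop (𝓝 ((P.map (X 0)).real C)) := by
  have hm : Measurable fun ω n => X n ω := measurable_pi_lambda _ hX
  have : IsProbabilityMeasure (seqLaw P X) := Measure.isProbabilityMeasure_map hm.aemeasurable
  have hg : Measurable fun s : ℕ → ℝ => C.indicator (fun _ => (1 : ℝ)) (s 0) :=
    (measurable_const.indicator hC).comp (measurable_pi_apply 0)
  have hgi : Integrable (fun s : ℕ → ℝ => C.indicator (fun _ => (1 : ℝ)) (s 0)) (seqLaw P X) :=
    Integrable.of_bound hg.aestronglyMeasurable 1 (ae_of_all _ fun s => by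
      rw [Real.norm_of_nonneg (Set.indicator_nonneg (fun _ _ => zero_le_one) _)]
      exact Set.indicator_le_self' (fun _ _ => zero_le_one) _)
  have h := Ergodic.ae_tendsto_birkhoffAverage hXerg hg hgi
  have hval : ∫ s, C.indicator (fun _ => (1 : ℝ)) (s 0) ∂seqLaw P X = (P.map (X 0)).real C := by
    rw [seqLaw, integral_map hm.aemeasurable hg.aestronglyMeasurable,
      ← integral_map (f := C.indicator fun _ => (1 : ℝ)) (hX 0).aemeasurable
        (measurable_const.indicator hC).aestronglyMeasurable,
      integral_indicator_const _ hC, smul_eq_mul, mul_one]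
  rw [hval] at h
  filter_upwards [ae_of_ae_map hm.aemeasurable h] with ω hω
  exact hω.congr fun n => birkhoffAverage_seqShift_eval C _ n

end Stationary

/-! ### The almost sure limit for the scaled sequence. -/

section ScaledLimit

variable {Ω : Type*} [MeasurableSpace Ω] {P : Measure Ω} {X : ℕ → Ω → ℝ} {V : Ω → ℝ} {k : ℕ → ℕ}
  {a : ℝ}

theorem ae_forall_lt_of_rightEndpoint (hX : ∀ n, Measurable (X n))
    (hstat : IsStrictlyStationary P X) {γ : ℝ} (hγ : P.map (X 0) {γ} = 0)
    (htop : P.map (X 0) (Set.Ioi γ) = 0) : ∀ᵐ ω ∂P, ∀ i, X i ω < γ := by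
  rw [ae_all_iff]
  intro i
  have hIci : P.map (X 0) (Set.Ici γ) = 0 := by
    rw [← Set.Ioi_union_left]
    exact measure_union_null htop hγ
  have h0 : ∀ᵐ ω ∂P, X 0 ω < γ := by
    rw [Measure.map_apply (hX 0) measurableSet_Ici] at hIci
    filter_upwards [measure_eq_zero_iff_ae_notMem.1 hIci] with ω hω
    exact not_le.1 hω
  exact hstat.ae_shift hX (p := fun s => s 0 < γ)
    (measurableSet_lt (measurable_pi_apply 0) measurable_const) h0 i

theorem measurable_limsup_coe :
    Measurable fun s : ℕ → ℝ => limsup (fun n => (s n : EReal)) atTop :=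
  Measurable.limsup fun n => measurable_coe_real_ereal.comp (measurable_pi_apply n)

theorem limsup_coe_shift (s : ℕ → ℝ) (i : ℕ) :
    limsup (fun n => (s (i + n) : EReal)) atTop = limsup (fun n => (s n : EReal)) atTop := by
  simp_rw [add_comm i]
  exact limsup_nat_add (fun n => (s n : EReal)) i

theorem ae_tendsto_nearCount_scaledLimit [IsProbabilityMeasure P]
    (hX : ∀ n, Measurable (X n)) (hV : Measurable V) (hVpos : ∀ᵐ ω ∂P, 0 < V ω)
    (hXerg : IsStationaryErgodic P X)
    (hSstat : IsStrictlyStationary P fun n ω => V ω * X n ω)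
    (hk : ∀ n, 1 ≤ n → 1 ≤ k n ∧ k n ≤ n)
    (hklim : Tendsto (fun n => (k n : ℝ) / n) atTop (𝓝 1))
    (hγ : rightEndpoint P (X 0) < ⊤)
    (hatom : P {ω | (X 0 ω : EReal) = rightEndpoint P (X 0)} = 0)
    (hatom' : P {ω | ((X 0 ω + a / V ω : ℝ) : EReal) = rightEndpoint P (X 0)} = 0) :
    ∀ᵐ ω ∂P, Tendsto (fun n : ℕ => (nearCount (fun i => V ω * X i ω) (k n) n a : ℝ) / n) atTop
      (𝓝 (scaledLimit P X V a ω)) := by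
  obtain ⟨γ, hγeq, hγpos, hγtop⟩ := exists_real_eq_rightEndpoint (hX 0) hγ
  have hS : ∀ n, Measurable fun ω => V ω * X n ω := fun n => hV.mul (hX n)
  have : IsProbabilityMeasure (P.map (X 0)) :=
    Measure.isProbabilityMeasure_map (hX 0).aemeasurable
  set ν := P.map (X 0) with hν
  rw [hγeq] at hatom hatom'
  have hγ0 : ν {γ} = 0 := by
    rw [hν, Measure.map_apply (hX 0) (measurableSet_singleton γ), ← hatom]
    congr 1
    ext ω
    exact EReal.coe_eq_coe_iff.symm
  have hadd : Measurable fun s : ℕ → ℝ => ((s 0 + a : ℝ) : EReal) :=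
    measurable_coe_real_ereal.comp
      (Measurable.add_const (measurable_pi_apply (X := fun _ : ℕ => ℝ) 0) a)
  have hXlt := ae_forall_lt_of_rightEndpoint hX hXerg.toMeasurePreserving hγ0 hγtop
  have hrat : ∀ᵐ ω ∂P, ∀ q : ℚ, Tendsto (visitFreq (Set.Ioi (q : ℝ)) fun i => X i ω) atTop
      (𝓝 (ν.real (Set.Ioi (q : ℝ)))) :=
    ae_all_iff.2 fun q => hXerg.ae_tendsto_visitFreq hX measurableSet_Ioi
  have hmul : ∀ {v : ℝ}, 0 < v → ∀ y (x : ℕ → ℝ) n,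
      visitFreq (Set.Ioi y) (fun i => v * x i) n = visitFreq (Set.Ioi (y / v)) x n :=
    fun {v} hv y x n => by
      rw [← visitFreq_Ioi_mul hv (y / v), mul_div_cancel₀ _ hv.ne']
  have hSpos : ∀ᵐ ω ∂P, ∀ δ > 0, ∃ p > 0, ∀ᶠ n in atTop,
      p ≤ visitFreq (Set.Ioi (V ω * γ - δ)) (fun i => V ω * X i ω) n := by
    filter_upwards [hVpos, hrat] with ω hv hq δ hδ
    simp only [hmul hv]
    refine exists_pos_eventually_le_visitFreq_Ioi hq ?_ hγpos
    rw [div_lt_iff₀ hv]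
    linarith
  have hlimsup : ∀ᵐ ω ∂P, limsup (fun i => ((V ω * X i ω : ℝ) : EReal)) atTop =
      ((V ω * γ : ℝ) : EReal) := by
    filter_upwards [hVpos, hXlt, hSpos] with ω hv hlt hp
    exact limsup_coe_eq (fun i => by gcongr; exact hlt i) hp
  -- `V` and `X` need not be jointly stationary, so the exclusion is rewritten as `S 0 + a ≠ limsup
  -- S` before shifting.
  have hne : ∀ᵐ ω ∂P, ∀ i, X i ω ≠ γ - a / V ω := by
    have h0 : ∀ᵐ ω ∂P, ((V ω * X 0 ω + a : ℝ) : EReal) ≠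
        limsup (fun i => ((V ω * X i ω : ℝ) : EReal)) atTop := by
      filter_upwards [hVpos, hlimsup, measure_eq_zero_iff_ae_notMem.1 hatom'] with ω hv hl hω heq
      rw [hl, EReal.coe_eq_coe_iff] at heq
      refine hω (EReal.coe_eq_coe_iff.2 ?_)
      field_simp
      linarith
    have h1 := fun i => hSstat.ae_shift hS
      (p := fun s => ((s 0 + a : ℝ) : EReal) ≠ limsup (fun n => (s n : EReal)) atTop)
      (measurableSet_eq_fun hadd measurable_limsup_coe).compl h0 i
    filter_upwards [hVpos, hlimsup, ae_all_iff.2 h1] with ω hv hl hω i heq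
    refine hω i ?_
    rw [limsup_coe_shift (fun n => V ω * X n ω) i, hl, add_zero, heq, EReal.coe_eq_coe_iff]
    field_simp
    ring
  have hcount : {y : ℝ | 0 < ν {y}}.Countable := by
    simpa using! Measure.countable_meas_level_set_pos (μ := ν) measurable_id
  have hatoms : ∀ᵐ ω ∂P, ∀ y ∈ {y : ℝ | 0 < ν {y}},
      Tendsto (visitFreq {y} fun i => X i ω) atTop (𝓝 (ν.real {y})) :=
    (ae_ball_iff hcount).2 fun y _ => hXerg.ae_tendsto_visitFreq hX (measurableSet_singleton y)
  -- Each of the countably many atoms of `ν` is visited with positive frequency, whereas `γ - a / V`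
  -- is never visited.
  have hnull : ∀ᵐ ω ∂P, ν {γ - a / V ω} = 0 := by
    filter_upwards [hatoms, hne] with ω hω hi
    by_contra hpos
    have hz : visitFreq {γ - a / V ω} (fun i => X i ω) = fun _ => 0 := by
      ext n
      have h0 : ∀ i, Set.indicator {γ - a / V ω} (fun _ => (1 : ℝ)) (X i ω) = 0 := fun i =>
        Set.indicator_of_notMem (by simpa using hi i) _
      simp [visitFreq, h0]
    have h1 := hω _ (pos_iff_ne_zero.2 hpos)
    rw [hz] at h1
    have h2 := tendsto_nhds_unique h1 tendsto_const_nhds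
    exact hpos ((measureReal_eq_zero_iff (measure_ne_top _ _)).1 h2)
  have hdiv : ∀ {v : ℝ}, 0 < v → ∀ δ, (v * γ - a - δ) / v = γ - a / v - δ / v := fun hv δ => by
    field_simp
  have htail : ∀ᵐ ω ∂P, Tendsto (visitFreq (Set.Ioi (V ω * γ - a)) fun i => V ω * X i ω) atTop
      (𝓝 (ν.real (Set.Ioi (γ - a / V ω)))) := by
    filter_upwards [hVpos, hrat, hnull] with ω hv hq h0
    refine (tendsto_visitFreq_Ioi hq h0).congr fun n => ?_
    have := hdiv hv 0
    rw [sub_zero, zero_div, sub_zero] at this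
    rw [hmul hv, this]
  have hnear : ∀ᵐ ω ∂P,
      Tendsto (fun n : ℕ => (nearCount (fun i => V ω * X i ω) (k n) n a : ℝ) / n) atTop
        (𝓝 (ν.real (Set.Ioi (γ - a / V ω)))) := by
    filter_upwards [hVpos, hrat, hnull, hXlt, hSpos, htail] with ω hv hq h0 hlt hp ht
    refine tendsto_nearCount_div hk hklim (M := V ω * γ) (fun i => by gcongr; exact hlt i) hp
      (fun ε hε => ?_) ht fun ε hε => ?_
    · obtain ⟨δ, hδ, hev⟩ := exists_pos_eventually_visitFreq_Ioi_le hq hγ0 hε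
      refine ⟨V ω * δ, by positivity, ?_⟩
      filter_upwards [hev] with n hn
      rw [measureReal_def, hγtop, ENNReal.toReal_zero, zero_add] at hn
      rwa [← mul_sub, visitFreq_Ioi_mul hv]
    · obtain ⟨δ, hδ, hev⟩ := exists_pos_eventually_visitFreq_Ioi_le hq h0 hε
      refine ⟨V ω * δ, by positivity, ?_⟩
      filter_upwards [hev] with n hn
      rwa [hmul hv, hdiv hv, mul_div_cancel_left₀ _ hv.ne']
  -- The event `X 0 + a / V > γ`, multiplied through by `V` and expressed by the path of `S` alone.
  let f : (ℕ → ℝ) → ℝ := Set.indicator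
    {s | limsup (fun n => (s n : EReal)) atTop < ((s 0 + a : ℝ) : EReal)} fun _ => 1
  have hfm : Measurable f := measurable_const.indicator (measurableSet_lt measurable_limsup_coe
    hadd)
  have hfb : ∀ s, |f s| ≤ 1 := fun s => by
    rw [abs_of_nonneg (Set.indicator_nonneg (fun _ _ => zero_le_one) _)]
    exact Set.indicator_le_self' (fun _ _ => zero_le_one) _
  have hbirk : ∀ᵐ ω ∂P, Tendsto
      (fun n => birkhoffAverage ℝ seqShift f n fun i => V ω * X i ω) atTop
      (𝓝 (ν.real (Set.Ioi (γ - a / V ω)))) := by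
    filter_upwards [hlimsup, htail] with ω hl ht
    refine ht.congr fun n => ?_
    rw [birkhoffAverage, birkhoffSum, visitFreq, smul_eq_mul, inv_mul_eq_div]
    congr 1
    refine Finset.sum_congr rfl fun i _ => ?_
    have hiff : V ω * X i ω ∈ Set.Ioi (V ω * γ - a) ↔
        (seqShift^[i] fun i => V ω * X i ω) ∈
          {s : ℕ → ℝ | limsup (fun n => (s n : EReal)) atTop < ((s 0 + a : ℝ) : EReal)} := by
      rw [seqShift_iterate]
      change V ω * γ - a < V ω * X i ω ↔ limsup (fun n => ((V ω * X (i + n) ω : ℝ) : EReal)) atTop <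
        ((V ω * X (i + 0) ω + a : ℝ) : EReal)
      rw [limsup_coe_shift (fun n => V ω * X n ω) i, hl, EReal.coe_lt_coe_iff, sub_lt_iff_lt_add,
        add_zero]
    by_cases hi : V ω * X i ω ∈ Set.Ioi (V ω * γ - a)
    · simp only [f, Set.indicator_of_mem hi, Set.indicator_of_mem (hiff.1 hi)]
    · simp only [f, Set.indicator_of_notMem hi, Set.indicator_of_notMem (mt hiff.2 hi)]
  have hcond := condExp_invariantSigma_ae_eq hS hSstat hfm hfb hbirk
  have hcongr : Set.indicator {ω | rightEndpoint P (X 0) < ((X 0 ω + a / V ω : ℝ) : EReal)}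
      (fun _ => (1 : ℝ)) =ᵐ[P] fun ω => f fun i => V ω * X i ω := by
    filter_upwards [hVpos, hlimsup] with ω hv hl
    have hiff : ω ∈ {ω | rightEndpoint P (X 0) < ((X 0 ω + a / V ω : ℝ) : EReal)} ↔
        (fun i => V ω * X i ω) ∈
          {s : ℕ → ℝ | limsup (fun n => (s n : EReal)) atTop < ((s 0 + a : ℝ) : EReal)} := by
      change rightEndpoint P (X 0) < ((X 0 ω + a / V ω : ℝ) : EReal) ↔
        limsup (fun n => ((V ω * X n ω : ℝ) : EReal)) atTop < ((V ω * X 0 ω + a : ℝ) : EReal)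
      rw [hl, hγeq, EReal.coe_lt_coe_iff, EReal.coe_lt_coe_iff, ← mul_lt_mul_iff_right₀ hv,
        mul_add, mul_div_cancel₀ _ hv.ne']
    by_cases hi : ω ∈ {ω | rightEndpoint P (X 0) < ((X 0 ω + a / V ω : ℝ) : EReal)}
    · simp only [f, Set.indicator_of_mem hi, Set.indicator_of_mem (hiff.1 hi)]
    · simp only [f, Set.indicator_of_notMem hi, Set.indicator_of_notMem (mt hiff.2 hi)]
  filter_upwards [hnear, hcond, condExp_congr_ae (m := invariantSigma fun n ω => V ω * X n ω) hcongr]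
    with ω h1 h2 h3
  rw [scaledLimit, h3, h2]
  exact h1

end ScaledLimit

/-! ### Random sample sizes and modes of convergence. -/

section RandomIndex

theorem tendsto_atTop_of_tendsto_div {ι : Type*} {l : Filter ι} {N : ι → ℕ} {c : ι → ℝ} {z : ℝ}
    (hz : 0 < z) (hc : Tendsto c l atTop) (h : Tendsto (fun t => (N t : ℝ) / c t) l (𝓝 z)) :
    Tendsto N l atTop := by
  rw [← tendsto_natCast_atTop_iff (R := ℝ)]
  refine (h.pos_mul_atTop hz hc).congr' ?_
  filter_upwards [hc.eventually_gt_atTop 0] with t ht using div_mul_cancel₀ _ ht.ne'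

variable {Ω : Type*} [MeasurableSpace Ω] {P : Measure Ω}

theorem tendstoInMeasure_of_forall_exists_subseq [IsFiniteMeasure P] {ι : Type*} {l : Filter ι}
    [l.IsCountablyGenerated] {f : ι → Ω → ℝ} {g : Ω → ℝ} (hf : ∀ i, Measurable (f i))
    (h : ∀ ns : ℕ → ι, Tendsto ns atTop l → ∃ ms : ℕ → ℕ,
      ∀ᵐ ω ∂P, Tendsto (fun j => f (ns (ms j)) ω) atTop (𝓝 (g ω))) :
    TendstoInMeasure P f l g := by
  intro ε hε
  refine tendsto_of_subseq_tendsto fun ns hns => ?_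
  obtain ⟨ms, hms⟩ := h ns hns
  exact ⟨ms, tendstoInMeasure_of_tendsto_ae (fun j => (hf _).aestronglyMeasurable) hms ε hε⟩

theorem exists_pos_measure_le_lt [IsFiniteMeasure P] {Z : Ω → ℝ} (hZ : Measurable Z)
    (hZpos : ∀ᵐ ω ∂P, 0 < Z ω) {η : ENNReal} (hη : 0 < η) :
    ∃ δ > 0, P.map Z (Set.Iic δ) < η := by
  have hlim : Tendsto (fun n : ℕ => P.map Z (Set.Iic (1 / ((n : ℝ) + 1)))) atTop
      (𝓝 (P.map Z (⋂ n : ℕ, Set.Iic (1 / ((n : ℝ) + 1))))) := by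
    refine tendsto_measure_iInter_atTop (fun n => measurableSet_Iic.nullMeasurableSet) ?_
      ⟨0, measure_ne_top _ _⟩
    intro m n hmn
    exact Set.Iic_subset_Iic.2 (Nat.one_div_le_one_div hmn)
  have hzero : P.map Z (⋂ n : ℕ, Set.Iic (1 / ((n : ℝ) + 1))) = 0 := by
    refine measure_mono_null (t := Set.Iic 0) (fun x hx => ?_) ?_
    · exact ge_of_tendsto' tendsto_one_div_add_atTop_nhds_zero_nat fun n =>
        Set.mem_Iic.1 (Set.mem_iInter.1 hx n)
    · rw [Measure.map_apply hZ measurableSet_Iic, measure_eq_zero_iff_ae_notMem]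
      filter_upwards [hZpos] with ω hω using not_le.2 hω
  rw [hzero] at hlim
  obtain ⟨n, hn⟩ := (hlim.eventually_lt_const hη).exists
  exact ⟨_, Nat.one_div_pos_of_nat, hn⟩

/-- This encodes `N t → ∞` in probability; the `+ 1` avoids inverting zero. The portmanteau bound on
`(-∞, δ]` makes `N / c ≤ δ` unlikely, because `Z > 0`. -/
theorem tendstoInMeasure_inv_of_tendstoInDistribution [IsProbabilityMeasure P] {ι : Type*}
    {l : Filter ι} {N : ι → Ω → ℕ} {Z : Ω → ℝ} {c : ι → ℝ} (hN : ∀ t, Measurable (N t))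
    (hZ : Measurable Z) (hZpos : ∀ᵐ ω ∂P, 0 < Z ω) (hc : Tendsto c l atTop)
    (h : TendstoInDistribution (fun t ω => (N t ω : ℝ) / c t) l Z (fun _ => P) P) :
    TendstoInMeasure P (fun t ω => ((N t ω : ℝ) + 1)⁻¹) l fun _ => 0 := by
  rw [tendstoInMeasure_iff_norm]
  intro ε hε
  rw [ENNReal.tendsto_nhds_zero]
  intro η hη
  obtain ⟨δ, hδ, hPδ⟩ := exists_pos_measure_le_lt hZ hZpos hη
  have hport := ProbabilityMeasure.limsup_measure_closed_le_of_tendsto h.tendsto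
    (isClosed_Iic (a := δ))
  have hev := eventually_lt_of_limsup_lt (hport.trans_lt hPδ)
  -- For `c t ≥ 1 / (ε * δ)`, `(N + 1)⁻¹ ≥ ε` gives `N + 1 ≤ ε⁻¹ ≤ c t * δ`, hence `N / c t ≤ δ`.
  filter_upwards [hev, hc.eventually_ge_atTop (1 / (ε * δ))] with t ht hct
  have hctpos : 0 < c t := lt_of_lt_of_le (by positivity) hct
  have hmeas : Measurable fun ω => (N t ω : ℝ) / c t :=
    (measurable_from_top.comp (hN t)).div_const _
  simp only [ProbabilityMeasure.coe_mk] at ht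
  rw [Measure.map_apply hmeas measurableSet_Iic] at ht
  refine (measure_mono fun ω hω => ?_).trans ht.le
  have h1 : ε ≤ ‖((N t ω : ℝ) + 1)⁻¹ - 0‖ := hω
  have hpos : (0 : ℝ) < (N t ω : ℝ) + 1 := by positivity
  rw [sub_zero, Real.norm_of_nonneg (by positivity), le_inv_comm₀ hε hpos] at h1
  have h2 : ε⁻¹ ≤ c t * δ := by
    rw [div_le_iff₀ (by positivity)] at hct
    rw [inv_le_iff_one_le_mul₀ hε]
    linarith
  rw [Set.mem_preimage, Set.mem_Iic, div_le_iff₀ hctpos]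
  linarith

theorem TendstoInMeasure.comp_random_index [IsProbabilityMeasure P] {ι : Type*} {l : Filter ι}
    [l.IsCountablyGenerated] {N : ι → Ω → ℕ} {R : ℕ → Ω → ℝ} {L : Ω → ℝ}
    (hRN : ∀ t, Measurable fun ω => R (N t ω) ω)
    (hR : ∀ᵐ ω ∂P, Tendsto (fun n => R n ω) atTop (𝓝 (L ω)))
    (h : TendstoInMeasure P (fun t ω => ((N t ω : ℝ) + 1)⁻¹) l fun _ => 0) :
    TendstoInMeasure P (fun t ω => R (N t ω) ω) l L := by
  refine tendstoInMeasure_of_forall_exists_subseq hRN fun ns hns => ?_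
  obtain ⟨ms, -, hms⟩ := (h.comp hns).exists_seq_tendsto_ae
  refine ⟨ms, ?_⟩
  filter_upwards [hR, hms] with ω h1 h2
  refine h1.comp (f := fun j => N (ns (ms j)) ω) ?_
  have h3 : Tendsto (fun j => ((N (ns (ms j)) ω : ℝ) + 1)⁻¹) atTop (𝓝[>] 0) :=
    tendsto_nhdsWithin_iff.2 ⟨h2, Eventually.of_forall fun j => Set.mem_Ioi.2 (by positivity)⟩
  have h4 := h3.inv_tendsto_nhdsGT_zero
  rw [← tendsto_natCast_atTop_iff (R := ℝ)]
  refine (tendsto_atTop_add_const_right _ (-1) h4).congr fun j => ?_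
  simp

theorem nearCount_div_eq_mul (x : ℕ → ℝ) (k : ℕ → ℕ) (n : ℕ) (a c : ℝ) :
    (nearCount x (k n) n a : ℝ) / c = (n : ℝ) / c * ((nearCount x (k n) n a : ℝ) / n) := by
  rcases Nat.eq_zero_or_pos n with rfl | hn
  · simp [nearCount]
  · have : (n : ℝ) ≠ 0 := by exact_mod_cast hn.ne'
    rw [div_mul_div_comm, mul_comm c, mul_div_mul_left _ _ this]

end RandomIndex

theorem theorem5p4 {Ω : Type*} [MeasurableSpace Ω] (P : Measure Ω) [IsProbabilityMeasure P]
    (X : ℕ → Ω → ℝ) (V : Ω → ℝ) (S : ℕ → Ω → ℝ) (k : ℕ → ℕ) (a : ℝ)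
    (hX : ∀ n, Measurable (X n)) (hV : Measurable V)
    (hVpos : ∀ᵐ ω ∂P, 0 < V ω)
    (hXerg : IsStationaryErgodic P X)
    (hS : S = fun n ω => V ω * X n ω)
    (hSstat : IsStrictlyStationary P S)
    (ha : 0 < a)
    (hk : ∀ n, 1 ≤ n → 1 ≤ k n ∧ k n ≤ n)
    (hklim : Tendsto (fun n => (k n : ℝ) / n) atTop (𝓝 1))
    (hγ : rightEndpoint P (X 0) < ⊤)
    (hatom : P {ω | (X 0 ω : EReal) = rightEndpoint P (X 0)} = 0)
    (hatom' : P {ω | ((X 0 ω + a / V ω : ℝ) : EReal) = rightEndpoint P (X 0)} = 0) :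
    (∀ᵐ ω ∂P, Tendsto (fun n : ℕ => (nearCount (fun i => S i ω) (k n) n a : ℝ) / n) atTop
      (𝓝 (scaledLimit P X V a ω))) ∧
    (∀ (N : ℝ≥0 → Ω → ℕ) (Z : Ω → ℝ) (c : ℝ≥0 → ℝ),
      (∀ t, Measurable (N t)) → Measurable Z → (∀ᵐ ω ∂P, 0 < Z ω) →
      (∀ t, 0 < t → 0 < c t) → Tendsto c atTop atTop →
      ((∀ᵐ ω ∂P, Tendsto (fun t => (N t ω : ℝ) / c t) atTop (𝓝 (Z ω))) →
        ∀ᵐ ω ∂P, Tendsto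
          (fun t => (nearCount (fun i => S i ω) (k (N t ω)) (N t ω) a : ℝ) / c t) atTop
          (𝓝 (Z ω * scaledLimit P X V a ω))) ∧
      (TendstoInMeasure P (fun t ω => (N t ω : ℝ) / c t) atTop Z →
        TendstoInMeasure P
          (fun t ω => (nearCount (fun i => S i ω) (k (N t ω)) (N t ω) a : ℝ) / c t) atTop
          (fun ω => Z ω * scaledLimit P X V a ω)) ∧
      (TendstoInDistribution (fun t ω => (N t ω : ℝ) / c t) atTop Z (fun _ => P) P →
        IsDegenerate P (scaledLimit P X V a) →
        TendstoInDistribution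
          (fun t ω => (nearCount (fun i => S i ω) (k (N t ω)) (N t ω) a : ℝ) / c t) atTop
          (fun ω => Z ω * scaledLimit P X V a ω) (fun _ => P) P)) := by
  subst hS
  have hS : ∀ n, Measurable fun ω => V ω * X n ω := fun n => hV.mul (hX n)
  have hR := ae_tendsto_nearCount_scaledLimit (a := a) hX hV hVpos hXerg hSstat hk hklim hγ hatom
    hatom'
  refine ⟨hR, fun N Z c hN hZ hZpos _ hc => ?_⟩
  have hmeas : ∀ t d, Measurable fun ω =>
      (nearCount (fun i => V ω * X i ω) (k (N t ω)) (N t ω) a : ℝ) / d := fun t d =>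
    (measurable_from_top.comp (measurable_nearCount_random hS (hN t) k a)).div_const d
  have hRN : ∀ t, Measurable fun ω =>
      (nearCount (fun i => V ω * X i ω) (k (N t ω)) (N t ω) a : ℝ) / N t ω := fun t =>
    (measurable_from_top.comp (measurable_nearCount_random hS (hN t) k a)).div
      (measurable_from_top.comp (hN t))
  -- Stated along any `ts` tending to infinity, to serve both the full limit and subsequences.
  have hpt : ∀ ω, 0 < Z ω →
      Tendsto (fun n : ℕ => (nearCount (fun i => V ω * X i ω) (k n) n a : ℝ) / n) atTop
        (𝓝 (scaledLimit P X V a ω)) →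
      ∀ {ι : Type} {l : Filter ι} {ts : ι → ℝ≥0}, Tendsto ts l atTop →
      Tendsto (fun j => (N (ts j) ω : ℝ) / c (ts j)) l (𝓝 (Z ω)) →
      Tendsto (fun j => (nearCount (fun i => V ω * X i ω) (k (N (ts j) ω)) (N (ts j) ω) a : ℝ) /
        c (ts j)) l (𝓝 (Z ω * scaledLimit P X V a ω)) := by
    intro ω hz hω ι l ts hts hNc
    have hNtop := tendsto_atTop_of_tendsto_div hz (hc.comp hts) hNc
    exact (hNc.mul (hω.comp hNtop)).congr fun j =>
      (nearCount_div_eq_mul (fun i => V ω * X i ω) k (N (ts j) ω) a (c (ts j))).symm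
  refine ⟨fun h => ?_, fun h => ?_, fun h hdeg => ?_⟩
  · filter_upwards [h, hZpos, hR] with ω h1 h2 h3
    exact hpt ω h2 h3 (ts := fun t => t) tendsto_id h1
  · refine tendstoInMeasure_of_forall_exists_subseq (fun t => hmeas t (c t)) fun ns hns => ?_
    obtain ⟨ms, hms, hlim⟩ := (h.comp hns).exists_seq_tendsto_ae
    refine ⟨ms, ?_⟩
    filter_upwards [hlim, hZpos, hR] with ω h1 h2 h3
    exact hpt ω h2 h3 (ts := fun j => ns (ms j)) (hns.comp hms.tendsto_atTop) h1
  · obtain ⟨q, hq⟩ := hdeg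
    have hinv := tendstoInMeasure_inv_of_tendstoInDistribution hN hZ hZpos hc h
    have hRq := (TendstoInMeasure.comp_random_index
      (R := fun n ω => (nearCount (fun i => V ω * X i ω) (k n) n a : ℝ) / n) hRN hR hinv).congr_right
      hq
    -- Slutsky's theorem: degeneracy is needed because joint convergence in distribution requires
    -- the second factor to have a constant limit here.
    have hprod := h.continuous_comp_prodMk_of_tendstoInMeasure_const
      (g := fun p : ℝ × ℝ => p.1 * p.2) (by fun_prop) hRq fun t => (hRN t).aemeasurable
    refine hprod.congr (fun t => ae_of_all _ fun ω => ?_) ?_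
    · exact (nearCount_div_eq_mul (fun i => V ω * X i ω) k (N t ω) a (c t)).symm
    · filter_upwards [hq] with ω hω
      rw [hω]
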